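/- Let $p$ be a prime, $N\in\{0,1,2,\dots\}\cup\{\infty\}$, $\Lambda_N=\{x\in\mathbb{Q}_p:|x|_p\le p^N\}$ ($\Lambda_\infty=\mathbb{Q}_p$), and let $\chi$ be the Haar measure on $\mathbb{Q}_p$ with $\chi(\mathbb{Z}_p)=1$, regarded as an outer measure on all subsets. For $l\in\mathbb{Q}_p$, $n\in\mathbb{Z}$ put $B_l^n=\{x\in\Lambda_N:|x-l|_p\le p^{-n}\}$. *Distance of maps.* For functions $f,g:I\to[0,\infty]$ and filters $\mathcal F,\mathcal G$ on $I$, let $\ell(f_{\mathcal F},g_{\mathcal G})=\inf\{r\in[0,\infty):\exists U\in\mathcal G\ \forall x\in U\ f(x)\le r\,g(x)\}$ if $\mathcal F\subseteq\mathcal G$, and $=\infty$ otherwise; let $\mathfrak a(f_{\mathcal F},g_{\mathcal G})=\max\bigl(0,\ln\max(\ell(f_{\mathcal F},g_{\mathcal G}),\ell(g_{\mathcal G},f_{\mathcal F}))\bigr)$. For maps $\Phi_1,\Phi_2$ from a set $X$ to $\mathbb{R}^d$, $\mathfrak a(\Phi_1,\Phi_2)$ is this quantity for the pseudometrics $\rho_i(x,y)=|\Phi_i(x)-\Phi_i(y)|$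 on $I=X\times X$, each taken with the filter generated by the sets $\{\rho_i<\varepsilon\}$, $\varepsilon>0$. *Automodel maps.* A continuous map $\Upsilon:\Lambda_N\to\mathbb{R}^d$ is automodel if for some integer $m\ge 0$ and for all $n\in\mathbb{Z}$, $l\in\Lambda_N$ there are isometries $E_{l,j,n}$ of $\mathbb{R}^d$ ($0\le j<p^m$) with $$\Upsilon(B_l^n)=\bigcup_{j=0}^{p^m-1}E_{l,j,n}\bigl(\Upsilon(B_{p^nj}^{n+m})\bigr),$$ where the $p^m$ sets on the right are clusters of level $n+m$, that is, $E_{l,j,n}(\Upsilon(B_{p^nj}^{n+m}))=\Upsilon(B_{c_j}^{n+m})$ with pairwise disjoint balls $B_{c_0}^{n+m},\dots,B_{c_{p^m-1}}^{n+m}$. A map $\Upsilon:\Lambda_N\to\mathbb{R}^d$ is quasi-automodel if $\mathfrak a(\Upsilon_k,\Upsilon)\to0$ for some sequence of automodel maps $\Upsilon_k:\Lambda_N\to\mathbb{R}^d$. *Measures.* For $D\ge0$, $\mathcal S^D$ is the set of functions $\zeta:[0,\infty]\to[0,\infty]$ for which there is a nondecreasing $\varsigma:[0,\infty]\to[0,\infty]$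 with $\varsigma(r)>0$ for $r>0$ and $\lim_{r\to0+}\varsigma(\lambda r)/\varsigma(r)=\lambda^D$ for all $\lambda>0$, such that $\ell(\zeta,\varsigma)\le1$ and $\ell(\varsigma,\zeta)\le1$ for the filter of neighbourhoods of $0$. For $A\subseteq\mathbb{R}^d$, $$k_\zeta(A)=\sup_{\delta>0}\inf\Bigl\{\sum_i\zeta(\operatorname{diam}S_i): \{S_i\}\text{ a countable cover of }A,\ \operatorname{diam}S_i\le\delta\Bigr\}.$$ **Proposition 3.** Let $\Upsilon:\Lambda_N\to\mathbb{R}^d$ be quasi-automodel, let $D\ge0$, and let $\zeta\in\mathcal S^D$ be such that $k_\zeta(\Upsilon(\mathbb{Z}_p))<\infty$ and $k_\zeta(\Upsilon(B_l^n)\cap\Upsilon(B_{l'}^{n'}))=0$ whenever $B_l^n\cap B_{l'}^{n'}=\emptyset$. Then for every $A\subseteq\mathbb{R}^d$ $$k_\zeta(A\cap\Upsilon(\Lambda_N))=k_\zeta(\Upsilon(\mathbb{Z}_p))\,\chi(\Upsilon^{-1}(A)).$$ Consequently, if $k_\zeta(\Upsilon(\mathbb{Z}_p))\ne0$, the normalized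 fractal measure $k_\zeta(\Upsilon(\mathbb{Z}_p))^{-1}k_\zeta(\,\cdot\,\cap\Upsilon(\Lambda_N))$ is the image $\chi(\Upsilon^{-1}(\cdot))$ of the Haar measure. -/

import Mathlib

open MeasureTheory Filter Topology
open scoped ENNReal NNReal

noncomputable section

namespace PadicFractal

/-- `ℓ(f_F, g_G)` for `[0, ∞]`-valued functions `f`, `g` with filters `F`, `G`: the infimum of the
finite `r` such that `f ≤ r g` on some member of `G`, provided every member of `F` is a member
of `G` (in Mathlib's order on filters: `G ≤ F`), and `∞` otherwise. -/
def ell {I : Type*} (f : I → ℝ≥0∞) (F : Filter I) (g : I → ℝ≥0∞) (G : Filter I) : ℝ≥0∞ :=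
  open Classical in
  if G ≤ F then ⨅ (r : ℝ≥0) (_ : ∀ᶠ x in G, f x ≤ r * g x), (r : ℝ≥0∞) else ∞

/-- The pseudometric `ln max (ℓ(f_F, g_G), ℓ(g_G, f_F))` with values in `[0, ∞]`. The truncation at
`0` matters only if both quantities `ℓ` vanish (`f` and `g` are degenerate near the filter). -/
def logDist {I : Type*} (f : I → ℝ≥0∞) (F : Filter I) (g : I → ℝ≥0∞) (G : Filter I) : EReal :=
  max 0 (ENNReal.log (max (ell f F g G) (ell g G f F)))

/-- The pseudometric on `X` induced by a map `Φ` into a metric space. -/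
def pullDist {X M : Type*} [PseudoEMetricSpace M] (Φ : X → M) (q : X × X) : ℝ≥0∞ :=
  edist (Φ q.1) (Φ q.2)

/-- The filter on `X × X` whose base are the preimages of the neighbourhoods of `0` under the
induced pseudometric. -/
def pullFilter {X M : Type*} [PseudoEMetricSpace M] (Φ : X → M) : Filter (X × X) :=
  comap (pullDist Φ) (𝓝 0)

/-- The distance between two maps from `X` into metric spaces. -/
def mapDist {X M₁ M₂ : Type*} [PseudoEMetricSpace M₁] [PseudoEMetricSpace M₂]
    (Φ₁ : X → M₁) (Φ₂ : X → M₂) : EReal :=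
  logDist (pullDist Φ₁) (pullFilter Φ₁) (pullDist Φ₂) (pullFilter Φ₂)

/-- The class `S^D`: gauge functions `ζ` that are equivalent at `0` (`ℓ ≤ 1` in both directions)
to a nondecreasing function `ς`, positive off `0`, with `ς (c r) / ς r → c ^ D` as `r → 0`. -/
def IsScaleGauge (D : ℝ) (ζ : ℝ≥0∞ → ℝ≥0∞) : Prop :=
  ∃ ς : ℝ≥0∞ → ℝ≥0∞, Monotone ς ∧ (∀ r, 0 < r → 0 < ς r) ∧
    (∀ c : ℝ≥0, 0 < c →
      Tendsto (fun r : ℝ≥0∞ => ς (c * r) / ς r) (𝓝[>] 0) (𝓝 ((c : ℝ≥0∞) ^ D))) ∧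
    ell ζ (𝓝 0) ς (𝓝 0) ≤ 1 ∧ ell ς (𝓝 0) ζ (𝓝 0) ≤ 1

/-- The measure `k_ζ` given by the Carathéodory construction: the supremum over `δ > 0` of the
infimum of `∑ ζ (diam Sᵢ)` over the countable covers by sets `Sᵢ` of diameter at most `δ`. It is
an outer measure, defined on all subsets. -/
def kMeasure {X : Type*} [EMetricSpace X] (ζ : ℝ≥0∞ → ℝ≥0∞) : OuterMeasure X :=
  OuterMeasure.mkMetric ζ

variable (p : ℕ) [Fact p.Prime]

/-- `Λ_N = {x ∈ ℚ_p : |x| ≤ p ^ N}`, with `Λ_∞ = ℚ_p`. -/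
def Lam (N : ℕ∞) : Set ℚ_[p] := {x | ∀ k : ℕ, N = k → ‖x‖ ≤ (p : ℝ) ^ k}

variable {p} in
/-- The ball `B_l^n = {x ∈ Λ_N : |x - l| ≤ p ^ (-n)}` in `Λ_N`. -/
def cball {N : ℕ∞} (l : ℚ_[p]) (n : ℤ) : Set (Lam p N) :=
  {x | ‖(x : ℚ_[p]) - l‖ ≤ (p : ℝ) ^ (-n)}

/-- The ring of `p`-adic integers, as a subset of `Λ_N`. -/
def intSet (N : ℕ∞) : Set (Lam p N) := {x | ‖(x : ℚ_[p])‖ ≤ 1}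

/-- The ring of `p`-adic integers as a compact set with nonempty interior. -/
def intCompact : TopologicalSpace.PositiveCompacts ℚ_[p] where
  carrier := Metric.closedBall 0 1
  isCompact' := isCompact_closedBall 0 1
  interior_nonempty' :=
    ⟨0, Metric.ball_subset_interior_closedBall (Metric.mem_ball_self one_pos)⟩

/-- The Haar measure on `ℚ_p` normalized to give the `p`-adic integers measure `1`. -/
def haarQp [MeasurableSpace ℚ_[p]] [BorelSpace ℚ_[p]] : Measure ℚ_[p] :=
  Measure.addHaarMeasure (intCompact p)

variable {p} {N : ℕ∞} {d : ℕ}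

/-- Automodel maps. For some `m`, the cluster `Υ(B_l^n)` of every ball is the union of `p ^ m`
isometric copies of the clusters `Υ(B_{p^n j}^{n+m})`, `0 ≤ j < p ^ m`, of the balls into which
`B_0^n` splits, and these copies are again clusters, of pairwise disjoint balls. -/
def IsAutomodel (Υ : Lam p N → EuclideanSpace ℝ (Fin d)) : Prop :=
  Continuous Υ ∧ ∃ m : ℕ, ∀ n : ℤ, ∀ l ∈ Lam p N,
    ∃ (E : Fin (p ^ m) → EuclideanSpace ℝ (Fin d) → EuclideanSpace ℝ (Fin d))
      (c : Fin (p ^ m) → ℚ_[p]),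
      (∀ j, Isometry (E j)) ∧
      Υ '' cball l n =
        ⋃ j : Fin (p ^ m), E j '' (Υ '' cball ((p : ℚ_[p]) ^ n * ((j : ℕ) : ℚ_[p])) (n + m)) ∧
      (∀ j, E j '' (Υ '' cball ((p : ℚ_[p]) ^ n * ((j : ℕ) : ℚ_[p])) (n + m)) =
        Υ '' cball (c j) (n + m)) ∧
      Pairwise fun i j => Disjoint (cball (N := N) (c i) (n + m)) (cball (c j) (n + m))

/-- Quasi-automodel maps: limits of automodel maps for the distance between maps. -/
def IsQuasiAutomodel (Υ : Lam p N → EuclideanSpace ℝ (Fin d)) : Prop :=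
  ∃ Υs : ℕ → Lam p N → EuclideanSpace ℝ (Fin d),
    (∀ k, IsAutomodel (Υs k)) ∧ Tendsto (fun k => mapDist (Υs k) Υ) atTop (𝓝 0)

end PadicFractal

end

/-!
Automodel maps are assembled from isometric copies of clusters, so all clusters of one level have
the same measure `k_ζ`. This survives the passage to the limit `Υ`: maps at small distance are
bi-Lipschitz related at small scales with a constant `L` close to `1`, which distorts `k_ζ` at most
by the factor `L ^ D`, as `ζ` scales like `r ^ D`, and preserves the null intersections. Since
`ℤ_p` splits into `p ^ n` balls of level `n`, it follows that `k_ζ ∘ Υ = c χ` on balls.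

The equality extends to arbitrary sets although `Υ` need not be injective. Open sets are disjoint
unions of balls, so `k_ζ (Υ T) ≤ c χ(T)` first for open `T` and then, by outer regularity, for every
`T`. For `T` in a ball `B` let `H` be a measurable hull of `Υ T`: applying this bound to
`B \ Υ⁻¹ H` and subtracting from `k_ζ (Υ B) = c χ(B)` leaves `c χ(T) ≤ k_ζ H = k_ζ (Υ T)`. The
images of disjoint balls overlap in null sets, so the reverse inequality on the pieces in the
balls adds up.
-/

namespace PadicFractal

section Ultrametric

open Metric

variable {X : Type*} [PseudoMetricSpace X] {r : ℕ → ℝ} {U : Set X}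

/-- The closed balls in `U` of radius one of the `r n` that are maximal: no `r k` with `k < n` gives
a ball in `U` with the same centre. If `r` decreases to `0` and `U` is open, they form a partition
of `U`. -/
def maximalBalls (r : ℕ → ℝ) (U : Set X) : Set (Set X) :=
  {B | ∃ x n, IsLeast {k | closedBall x (r k) ⊆ U} n ∧ closedBall x (r n) = B}

theorem sUnion_maximalBalls (hr_pos : ∀ n, 0 < r n) (hr_lim : Tendsto r atTop (𝓝 0))
    (hU : IsOpen U) : ⋃₀ maximalBalls r U = U := by
  classical
  refine Set.Subset.antisymm (Set.sUnion_subset ?_) fun x hx => ?_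
  · rintro _ ⟨x, n, hn, rfl⟩
    exact hn.1
  · have hex : ∃ n, closedBall x (r n) ⊆ U := by
      obtain ⟨ε, hε, hεU⟩ := nhds_basis_closedBall.mem_iff.1 (hU.mem_nhds hx)
      obtain ⟨n, hn⟩ := (hr_lim.eventually (ge_mem_nhds hε)).exists
      exact ⟨n, (closedBall_subset_closedBall hn).trans hεU⟩
    exact ⟨_, ⟨x, _, Nat.isLeast_find hex, rfl⟩, mem_closedBall_self (hr_pos _).le⟩

variable [IsUltrametricDist X]

theorem closedBall_eq_of_mem_closedBall_of_le {x y : X} {s t : ℝ} (hy : y ∈ closedBall x s)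
    (hst : s ≤ t) : closedBall x t = closedBall y t :=
  IsUltrametricDist.closedBall_eq_of_mem (closedBall_subset_closedBall hst hy)

theorem isLeast_closedBall_subset_of_mem (hr : Antitone r) {x y : X} {n : ℕ}
    (hn : IsLeast {k | closedBall x (r k) ⊆ U} n) (hy : y ∈ closedBall x (r n)) :
    IsLeast {k | closedBall y (r k) ⊆ U} n := by
  have hxy : ∀ k ≤ n, closedBall x (r k) = closedBall y (r k) := fun k hk =>
    closedBall_eq_of_mem_closedBall_of_le hy (hr hk)
  refine ⟨(hxy n le_rfl).symm.trans_subset hn.1, fun k hk => le_of_not_gt fun hkn => ?_⟩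
  exact hkn.not_ge (hn.2 ((hxy k hkn.le).trans_subset hk))

theorem pairwiseDisjoint_maximalBalls (hr : Antitone r) :
    (maximalBalls r U).PairwiseDisjoint id := by
  rintro _ ⟨x, m, hm, rfl⟩ _ ⟨y, n, hn, rfl⟩ hne
  refine Set.disjoint_left.2 fun z (hzx : z ∈ closedBall x (r m)) (hzy : z ∈ closedBall y (r n)) =>
    hne ?_
  obtain rfl : m = n := (isLeast_closedBall_subset_of_mem hr hm hzx).unique
    (isLeast_closedBall_subset_of_mem hr hn hzy)
  rw [IsUltrametricDist.closedBall_eq_of_mem hzx, IsUltrametricDist.closedBall_eq_of_mem hzy]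

theorem countable_maximalBalls [TopologicalSpace.SeparableSpace X] (hr : Antitone r)
    (hr_pos : ∀ n, 0 < r n) : (maximalBalls r U).Countable := by
  refine (pairwiseDisjoint_maximalBalls hr).countable_of_isOpen ?_ ?_
  · rintro _ ⟨x, n, -, rfl⟩
    exact IsUltrametricDist.isOpen_closedBall x (hr_pos n).ne'
  · rintro _ ⟨x, n, -, rfl⟩
    exact nonempty_closedBall.2 (hr_pos n).le

variable [MeasurableSpace X] [OpensMeasurableSpace X]

theorem outerMeasure_le_of_closedBall_le [TopologicalSpace.SeparableSpace X] {μ : Measure X}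
    [μ.OuterRegular] {m : OuterMeasure X} (hr : Antitone r) (hr_pos : ∀ n, 0 < r n)
    (hr_lim : Tendsto r atTop (𝓝 0))
    (hm : ∀ x n, m (closedBall x (r n)) ≤ μ (closedBall x (r n))) : m ≤ μ.toOuterMeasure := by
  have h_open : ∀ U, IsOpen U → m U ≤ μ U := fun U hU => by
    have hcount := countable_maximalBalls (U := U) hr hr_pos
    have := hcount.to_subtype
    calc m U = m (⋃ B : maximalBalls r U, B) := by
          rw [← Set.sUnion_eq_iUnion, sUnion_maximalBalls hr_pos hr_lim hU]
      _ ≤ ∑' B : maximalBalls r U, m B := measure_iUnion_le _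
      _ ≤ ∑' B : maximalBalls r U, μ B := by
          refine ENNReal.tsum_le_tsum ?_
          rintro ⟨_, x, n, -, rfl⟩
          exact hm x n
      _ = μ U := by
          rw [← measure_sUnion hcount (pairwiseDisjoint_maximalBalls hr),
            sUnion_maximalBalls hr_pos hr_lim hU]
          rintro _ ⟨x, n, -, rfl⟩
          exact measurableSet_closedBall
  intro S
  rw [Measure.coe_toOuterMeasure, S.measure_eq_iInf_isOpen μ]
  exact le_iInf₂ fun U hSU => le_iInf fun hU => (measure_mono hSU).trans (h_open U hU)

end Ultrametric

section Image

variable {X Y : Type*} [MeasurableSpace X] [MeasurableSpace Y] {f : X → Y}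
  {μ : Measure X} {κ : Measure Y}

-- If the image of some `T ⊆ B` were too small, its complement in `B` would be too large.
theorem measure_le_measure_image_of_subset (hf : Measurable f) (hle : ∀ S, κ (f '' S) ≤ μ S)
    {B T : Set X} (hBfin : μ B ≠ ∞) (hB : μ B ≤ κ (f '' B)) (hTB : T ⊆ B) :
    μ T ≤ κ (f '' T) := by
  set H := toMeasurable κ (f '' T)
  have hT : T ⊆ B ∩ f ⁻¹' H := Set.subset_inter hTB
    (Set.image_subset_iff.1 (subset_toMeasurable κ (f '' T)))
  have hdiff : μ (B \ f ⁻¹' H) ≠ ∞ := measure_ne_top_of_subset Set.sdiff_subset hBfin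
  have hBH : μ (B ∩ f ⁻¹' H) ≤ κ (f '' (B ∩ f ⁻¹' H)) := by
    refine (ENNReal.add_le_add_iff_right hdiff).1 ?_
    calc μ (B ∩ f ⁻¹' H) + μ (B \ f ⁻¹' H)
        = μ B := measure_inter_add_sdiff B (hf (measurableSet_toMeasurable κ _))
      _ ≤ κ (f '' (B ∩ f ⁻¹' H) ∪ f '' (B \ f ⁻¹' H)) := by
          rwa [← Set.image_union, Set.inter_union_sdiff]
      _ ≤ κ (f '' (B ∩ f ⁻¹' H)) + κ (f '' (B \ f ⁻¹' H)) := measure_union_le _ _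
      _ ≤ κ (f '' (B ∩ f ⁻¹' H)) + μ (B \ f ⁻¹' H) := by gcongr; exact hle _
  calc μ T ≤ κ (f '' (B ∩ f ⁻¹' H)) := (measure_mono hT).trans hBH
    _ ≤ κ H := measure_mono (Set.image_subset_iff.2 Set.inter_subset_right)
    _ = κ (f '' T) := measure_toMeasurable _

theorem tsum_measure_inter_le {ι : Type*} {M : ι → Set Y} (hM : ∀ i, MeasurableSet (M i))
    (hd : Pairwise (Function.onFun (AEDisjoint κ) M)) (A : Set Y) :
    ∑' i, κ (A ∩ M i) ≤ κ A := by
  calc ∑' i, κ (A ∩ M i) = ∑' i, κ.restrict A (M i) := by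
        simp only [Measure.restrict_apply (hM _), Set.inter_comm]
    _ ≤ κ.restrict A Set.univ :=
        tsum_measure_le_measure_univ (fun i => (hM i).nullMeasurableSet) fun _ _ hij =>
          Measure.absolutelyContinuous_of_le Measure.restrict_le_self (hd hij)
    _ = κ A := Measure.restrict_apply_univ A

end Image

section UltrametricImage

open Metric

variable {X Y : Type*} [PseudoMetricSpace X] [IsUltrametricDist X] [ProperSpace X]
  [MeasurableSpace X] [BorelSpace X] [TopologicalSpace Y] [T2Space Y] [MeasurableSpace Y]
  [BorelSpace Y] {f : X → Y} {μ : Measure X} [μ.OuterRegular] {κ : Measure Y} {r : ℕ → ℝ}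

theorem measure_image_eq_of_closedBall (hf : Continuous f)
    (hr : Antitone r) (hr_pos : ∀ n, 0 < r n) (hr_lim : Tendsto r atTop (𝓝 0))
    (hμ : ∀ x n, μ (closedBall x (r n)) ≠ ∞)
    (hκ : ∀ x n, κ (f '' closedBall x (r n)) = μ (closedBall x (r n)))
    (hdisj : ∀ x y m n, Disjoint (closedBall x (r m)) (closedBall y (r n)) →
      AEDisjoint κ (f '' closedBall x (r m)) (f '' closedBall y (r n))) (T : Set X) :
    κ (f '' T) = μ T := by
  have hle : ∀ S, κ (f '' S) ≤ μ S := outerMeasure_le_of_closedBall_le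
    (m := OuterMeasure.comap f κ.toOuterMeasure) hr hr_pos hr_lim fun x n => (hκ x n).le
  refine (hle T).antisymm ?_
  let 𝓑 : Set (Set X) := maximalBalls r Set.univ
  have : Countable 𝓑 := (countable_maximalBalls hr hr_pos).to_subtype
  have hcover : T = ⋃ B : 𝓑, T ∩ B := by
    rw [← Set.inter_iUnion, ← Set.sUnion_eq_iUnion, sUnion_maximalBalls hr_pos hr_lim isOpen_univ,
      Set.inter_univ]
  have hmeas : ∀ B : 𝓑, MeasurableSet (f '' B) := by
    rintro ⟨_, x, n, -, rfl⟩
    exact ((isCompact_closedBall x (r n)).image hf).measurableSet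
  have hae : Pairwise (Function.onFun (AEDisjoint κ) fun B : 𝓑 => f '' B) := by
    rintro ⟨_, x, m, hm, rfl⟩ ⟨_, y, n, hn, rfl⟩ hne
    exact hdisj x y m n (pairwiseDisjoint_maximalBalls hr ⟨x, m, hm, rfl⟩ ⟨y, n, hn, rfl⟩
      (Subtype.coe_ne_coe.2 hne))
  calc μ T ≤ ∑' B : 𝓑, μ (T ∩ B) := by
        conv_lhs => rw [hcover]
        exact measure_iUnion_le _
    _ ≤ ∑' B : 𝓑, κ (f '' (T ∩ B)) := by
        refine ENNReal.tsum_le_tsum ?_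
        rintro ⟨_, x, n, -, rfl⟩
        exact measure_le_measure_image_of_subset hf.measurable hle (hμ x n) (hκ x n).ge
          Set.inter_subset_right
    _ ≤ ∑' B : 𝓑, κ (f '' T ∩ f '' B) := by gcongr; exact Set.image_inter_subset _ _ _
    _ ≤ κ (f '' T) := tsum_measure_inter_le hmeas hae _

end UltrametricImage

section Gauge

theorem eventually_le_of_ell_lt {I : Type*} {f g : I → ℝ≥0∞} {F G : Filter I} {L : ℝ≥0∞}
    (h : ell f F g G < L) : ∀ᶠ x in G, f x ≤ L * g x := by
  unfold ell at h
  split_ifs at h with hle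
  · simp only [iInf_lt_iff] at h
    obtain ⟨r, hr, hrL⟩ := h
    exact hr.mono fun x hx => hx.trans (by gcongr)
  · exact absurd h not_top_lt

theorem le_of_forall_one_lt_le_rpow_mul {a b : ℝ≥0∞} (D : ℝ)
    (h : ∀ L : ℝ≥0, 1 < L → a ≤ (L : ℝ≥0∞) ^ D * b) : a ≤ b := by
  have hpow : Tendsto (fun L : ℝ≥0 => (L : ℝ≥0∞) ^ D) (𝓝[>] 1) (𝓝 1) := by
    have h_cont : Continuous fun L : ℝ≥0 => (L : ℝ≥0∞) ^ D :=
      ENNReal.continuous_rpow_const.comp ENNReal.continuous_coe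
    simpa using (h_cont.tendsto 1).mono_left (nhdsWithin_le_nhds (s := Set.Ioi 1))
  have hmul : Tendsto (fun L : ℝ≥0 => (L : ℝ≥0∞) ^ D * b) (𝓝[>] 1) (𝓝 b) := by
    simpa using ENNReal.Tendsto.mul_const hpow (Or.inl one_ne_zero)
  exact ge_of_tendsto hmul (eventually_mem_nhdsWithin.mono h)

theorem le_of_forall_one_lt_le_coe_mul {a b : ℝ≥0∞}
    (h : ∀ θ : ℝ≥0, 1 < θ → a ≤ θ * b) : a ≤ b :=
  le_of_forall_one_lt_le_rpow_mul 1 (by simpa using h)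

theorem eventually_apply_mul_le {ς : ℝ≥0∞ → ℝ≥0∞} {c A B : ℝ≥0∞} (hpos : ∀ r, 0 < r → 0 < ς r)
    (hlim : Tendsto (fun r => ς (c * r) / ς r) (𝓝[>] 0) (𝓝 A)) (hAB : A < B) (hB : 1 ≤ B) :
    ∀ᶠ r in 𝓝 0, ς (c * r) ≤ B * ς r := by
  filter_upwards [eventually_nhdsWithin_iff.1 (hlim.eventually (gt_mem_nhds hAB))] with r hr
  rcases eq_or_ne r 0 with rfl | hr0
  · simpa using mul_le_mul_left hB (ς 0)
  · have hr_pos := pos_iff_ne_zero.2 hr0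
    exact (ENNReal.div_le_iff_le_mul (.inl (hpos r hr_pos).ne') (.inr hAB.ne_bot)).1
      (hr hr_pos).le

variable {X Y Z : Type*} [EMetricSpace X] [EMetricSpace Y] [EMetricSpace Z]

theorem kMeasure_le_mul {ζ ς : ℝ≥0∞ → ℝ≥0∞} {c : ℝ≥0∞} (hc : c ≠ ∞) (hc0 : c ≠ 0)
    (h : ∀ᶠ r in 𝓝 0, ζ r ≤ c * ς r) (A : Set X) : kMeasure ζ A ≤ c * kMeasure ς A :=
  OuterMeasure.mkMetric_mono_smul hc hc0 (h.filter_mono nhdsWithin_le_nhds) A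

theorem kMeasure_le_of_ell_le_one {ζ ς : ℝ≥0∞ → ℝ≥0∞} (h : ell ζ (𝓝 0) ς (𝓝 0) ≤ 1)
    (A : Set X) : kMeasure ζ A ≤ kMeasure ς A :=
  le_of_forall_one_lt_le_coe_mul fun _ hθ =>
    kMeasure_le_mul ENNReal.coe_ne_top (ENNReal.coe_ne_zero.2 (one_pos.trans hθ).ne')
      (eventually_le_of_ell_lt (h.trans_lt (ENNReal.one_lt_coe_iff.2 hθ))) A

theorem kMeasure_eq_of_ell_le_one {ζ ς : ℝ≥0∞ → ℝ≥0∞} (h : ell ζ (𝓝 0) ς (𝓝 0) ≤ 1)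
    (h' : ell ς (𝓝 0) ζ (𝓝 0) ≤ 1) : (kMeasure ζ : OuterMeasure X) = kMeasure ς :=
  OuterMeasure.ext fun A =>
    (kMeasure_le_of_ell_le_one h A).antisymm (kMeasure_le_of_ell_le_one h' A)

theorem IsScaleGauge.kMeasure_image_of_isometry {D : ℝ} {ζ : ℝ≥0∞ → ℝ≥0∞}
    (hζ : IsScaleGauge D ζ) {E : Y → Z} (hE : Isometry E) (A : Set Y) :
    kMeasure ζ (E '' A) = kMeasure ζ A := by
  obtain ⟨ς, hς, -, -, h, h'⟩ := hζ
  rw [kMeasure_eq_of_ell_le_one h h', kMeasure_eq_of_ell_le_one h h', kMeasure, kMeasure,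
    ← OuterMeasure.isometry_comap_mkMetric ς hE (.inl hς), OuterMeasure.comap_apply]

end Gauge

section LocallyExpands

variable {X Y Z : Type*} [EMetricSpace Y] [EMetricSpace Z] {L : ℝ≥0} {f : X → Y} {g : X → Z}

/-- `g` expands the small `f`-distances at most by the factor `L`. Two maps at distance less than
`ln L` in the sense of `mapDist` have this property in both directions. -/
def LocallyExpandsBy (L : ℝ≥0) (f : X → Y) (g : X → Z) : Prop :=
  ∃ ε : ℝ≥0∞, 0 < ε ∧ ∀ x y, edist (f x) (f y) ≤ ε → edist (g x) (g y) ≤ L * edist (f x) (f y)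

theorem locallyExpandsBy_of_ell_lt
    (h : ell (pullDist g) (pullFilter g) (pullDist f) (pullFilter f) < L) :
    LocallyExpandsBy L f g := by
  obtain ⟨ε, hε, hfg⟩ := ((ENNReal.nhds_zero_basis_Iic.comap (pullDist f)).eventually_iff).1
    (eventually_le_of_ell_lt h)
  exact ⟨ε, hε, fun x y hxy => hfg (x := (x, y)) hxy⟩

theorem eventually_locallyExpandsBy {ι : Type*} {l : Filter ι} {Φ : ι → X → Y} {Ψ : X → Z}
    (h : Tendsto (fun i => mapDist (Φ i) Ψ) l (𝓝 0)) (hL : 1 < L) :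
    ∀ᶠ i in l, LocallyExpandsBy L Ψ (Φ i) ∧ LocallyExpandsBy L (Φ i) Ψ := by
  have hlog : 0 < ENNReal.log L := ENNReal.zero_lt_log_iff.2 (ENNReal.one_lt_coe_iff.2 hL)
  filter_upwards [h.eventually (gt_mem_nhds hlog)] with i hi
  rw [mapDist, logDist, max_lt_iff, ENNReal.log_lt_log_iff, max_lt_iff] at hi
  exact ⟨locallyExpandsBy_of_ell_lt hi.2.1, locallyExpandsBy_of_ell_lt hi.2.2⟩

namespace LocallyExpandsBy

theorem eq_of_eq (h : LocallyExpandsBy L f g) {x y : X} (hxy : f x = f y) : g x = g y := by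
  obtain ⟨ε, -, hfg⟩ := h
  simpa [hxy] using hfg x y (by simp [hxy])

theorem continuous [TopologicalSpace X] (h : LocallyExpandsBy L f g) (hf : Continuous f) :
    Continuous g := by
  obtain ⟨ε, hε, hfg⟩ := h
  refine continuous_iff_continuousAt.2 fun x => tendsto_iff_edist_tendsto_0.2 ?_
  have hfx : Tendsto (fun y => edist (f y) (f x)) (𝓝 x) (𝓝 0) :=
    tendsto_iff_edist_tendsto_0.1 hf.continuousAt
  have hLfx : Tendsto (fun y => L * edist (f y) (f x)) (𝓝 x) (𝓝 0) := by
    simpa using ENNReal.Tendsto.const_mul hfx (.inr ENNReal.coe_ne_top)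
  exact tendsto_of_tendsto_of_tendsto_of_le_of_le' tendsto_const_nhds hLfx
    (.of_forall fun _ => zero_le) ((hfx.eventually (ge_mem_nhds hε)).mono fun y => hfg y x)

theorem exists_ediam_image_le (h : LocallyExpandsBy L f g) :
    ∃ ε : ℝ≥0∞, 0 < ε ∧ ∀ T : Set Y, Metric.ediam T ≤ ε →
      Metric.ediam (g '' (f ⁻¹' T)) ≤ L * Metric.ediam T := by
  obtain ⟨ε, hε, hfg⟩ := h
  refine ⟨ε, hε, fun T hT => Metric.ediam_le ?_⟩
  rintro _ ⟨x, hx, rfl⟩ _ ⟨y, hy, rfl⟩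
  have hxy : edist (f x) (f y) ≤ Metric.ediam T := Metric.edist_le_ediam_of_mem hx hy
  exact (hfg x y (hxy.trans hT)).trans (by gcongr)

-- Carrying the `r`-approximation of `kMeasure ς` over to `Y` by `g` and `f` gives an outer measure
-- that is at most `ς (L * diam T)` on small sets `T`, and `kMeasure` is the largest such one.
theorem kMeasure_image_le {ς : ℝ≥0∞ → ℝ≥0∞} (hς : Monotone ς) (h : LocallyExpandsBy L f g)
    (S : Set X) : kMeasure ς (g '' S) ≤ kMeasure (fun r => ς (L * r)) (f '' S) := by
  obtain ⟨ε, hε, hfg⟩ := h.exists_ediam_image_le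
  change (⨆ r > 0, OuterMeasure.mkMetric'.pre (fun T => ς (Metric.ediam T)) r) (g '' S) ≤ _
  simp only [OuterMeasure.iSup_apply]
  refine iSup₂_le fun r hr => ?_
  let pre : OuterMeasure Z := OuterMeasure.mkMetric'.pre (fun T => ς (Metric.ediam T)) r
  let pulled : OuterMeasure Y := OuterMeasure.map f (OuterMeasure.comap g pre)
  have hpulled : pulled ≤ kMeasure fun r => ς (L * r) := by
    refine OuterMeasure.le_mkMetric _ _ (min ε (r / L)) ?_ fun T hT => ?_
    · exact lt_min hε (ENNReal.div_pos hr.ne' ENNReal.coe_ne_top)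
    · have hdiam : Metric.ediam (g '' (f ⁻¹' T)) ≤ L * Metric.ediam T :=
        hfg T (hT.trans (min_le_left _ _))
      exact (OuterMeasure.mkMetric'.pre_le (hdiam.trans (ENNReal.mul_le_of_le_div'
        (hT.trans (min_le_right _ _))))).trans (hς hdiam)
  calc pre (g '' S) ≤ pre (g '' (f ⁻¹' (f '' S))) := by
        gcongr; exact Set.subset_preimage_image f S
    _ = pulled (f '' S) := by simp [pulled]
    _ ≤ kMeasure (fun r => ς (L * r)) (f '' S) := hpulled _

end LocallyExpandsBy

theorem IsScaleGauge.kMeasure_image_le {D : ℝ} {ζ : ℝ≥0∞ → ℝ≥0∞} (hζ : IsScaleGauge D ζ)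
    (hD : 0 ≤ D) (hL : 1 ≤ L) (h : LocallyExpandsBy L f g) (S : Set X) :
    kMeasure ζ (g '' S) ≤ (L : ℝ≥0∞) ^ D * kMeasure ζ (f '' S) := by
  obtain ⟨ς, hς, hς_pos, hς_lim, hζς, hςζ⟩ := hζ
  rw [kMeasure_eq_of_ell_le_one hζς hςζ, kMeasure_eq_of_ell_le_one hζς hςζ]
  have hLD : 1 ≤ (L : ℝ≥0∞) ^ D := by
    simpa using ENNReal.rpow_le_rpow (ENNReal.one_le_coe_iff.2 hL) hD
  have hLD_ne_zero : (L : ℝ≥0∞) ^ D ≠ 0 := (one_pos.trans_le hLD).ne'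
  have hLD_ne_top : (L : ℝ≥0∞) ^ D ≠ ∞ := ENNReal.rpow_ne_top_of_nonneg hD ENNReal.coe_ne_top
  refine le_of_forall_one_lt_le_coe_mul fun θ hθ => ?_
  have hθ' : (1 : ℝ≥0∞) < θ := ENNReal.one_lt_coe_iff.2 hθ
  have h_lt : (L : ℝ≥0∞) ^ D < θ * (L : ℝ≥0∞) ^ D := by
    simpa using ENNReal.mul_lt_mul_left hLD_ne_zero hLD_ne_top hθ'
  calc kMeasure ς (g '' S) ≤ kMeasure (fun r => ς (L * r)) (f '' S) := h.kMeasure_image_le hς S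
    _ ≤ (θ * (L : ℝ≥0∞) ^ D) * kMeasure ς (f '' S) :=
        kMeasure_le_mul (ENNReal.mul_ne_top ENNReal.coe_ne_top hLD_ne_top) h_lt.ne_bot
          (eventually_apply_mul_le hς_pos (hς_lim L (one_pos.trans_le hL)) h_lt
            (hLD.trans h_lt.le)) _
    _ = θ * ((L : ℝ≥0∞) ^ D * kMeasure ς (f '' S)) := mul_assoc _ _ _

theorem IsScaleGauge.kMeasure_image_inter_image_eq_zero {D : ℝ} {ζ : ℝ≥0∞ → ℝ≥0∞}
    (hζ : IsScaleGauge D ζ) (hD : 0 ≤ D) (hL : 1 ≤ L) (h : LocallyExpandsBy L f g)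
    (h' : LocallyExpandsBy L g f) {S T : Set X} (hST : kMeasure ζ (f '' S ∩ f '' T) = 0) :
    kMeasure ζ (g '' S ∩ g '' T) = 0 := by
  have hsub : g '' S ∩ g '' T ⊆ g '' (S ∩ f ⁻¹' (f '' T)) := by
    rintro _ ⟨⟨x, hx, rfl⟩, y, hy, hxy⟩
    exact ⟨x, ⟨hx, y, hy, h'.eq_of_eq hxy⟩, rfl⟩
  have hle := hζ.kMeasure_image_le hD hL h (S ∩ f ⁻¹' (f '' T))
  rw [Set.image_inter_preimage, hST, mul_zero] at hle
  exact measure_mono_null hsub (nonpos_iff_eq_zero.1 hle)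

end LocallyExpands

section Balls

open Metric

variable {p : ℕ} [hp : Fact p.Prime] {N : ℕ∞}

theorem exists_norm_sub_natCast_le {y : ℚ_[p]} (hy : ‖y‖ ≤ 1) (m : ℕ) :
    ∃ j : Fin (p ^ m), ‖y - (j : ℕ)‖ ≤ (p : ℝ) ^ (-m : ℤ) := by
  let z : ℤ_[p] := ⟨y, hy⟩
  exact ⟨⟨z.appr m, z.appr_lt m⟩, (PadicInt.norm_le_pow_iff_mem_span_pow _ m).2 (z.appr_spec m)⟩

theorem eq_of_norm_natCast_sub_le {m : ℕ} {i j : Fin (p ^ m)}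
    (h : ‖((i : ℕ) : ℚ_[p]) - (j : ℕ)‖ ≤ (p : ℝ) ^ (-m : ℤ)) : i = j := by
  have hdvd : ((p ^ m : ℕ) : ℤ) ∣ (i : ℤ) - (j : ℤ) := by
    exact_mod_cast (Padic.norm_int_le_pow_iff_dvd ((i : ℤ) - (j : ℤ)) m).1 (by simpa using h)
  have := Int.eq_zero_of_abs_lt_dvd hdvd (by rw [abs_lt]; omega)
  exact Fin.ext (by omega)

theorem add_p_zpow_mul_mem_closedBall_iff (l y z : ℚ_[p]) (n m : ℤ) :
    l + (p : ℚ_[p]) ^ n * y ∈ closedBall (l + (p : ℚ_[p]) ^ n * z) ((p : ℝ) ^ (-(n + m))) ↔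
      ‖y - z‖ ≤ (p : ℝ) ^ (-m) := by
  have hp0 : (0 : ℝ) < p := Nat.cast_pos.2 hp.out.pos
  rw [mem_closedBall, dist_eq_norm, add_sub_add_left_eq_sub, ← mul_sub, norm_mul,
    Padic.norm_p_zpow, neg_add, zpow_add₀ hp0.ne', mul_le_mul_iff_right₀ (zpow_pos hp0 _)]

theorem add_p_zpow_mul_mem_closedBall_self_iff (l y : ℚ_[p]) (n : ℤ) :
    l + (p : ℚ_[p]) ^ n * y ∈ closedBall l ((p : ℝ) ^ (-n)) ↔ ‖y‖ ≤ 1 := by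
  simpa using add_p_zpow_mul_mem_closedBall_iff l y 0 n 0

theorem norm_le_one_of_norm_sub_natCast_le {y : ℚ_[p]} {j m : ℕ}
    (h : ‖y - j‖ ≤ (p : ℝ) ^ (-m : ℤ)) : ‖y‖ ≤ 1 := by
  have hpm : (p : ℝ) ^ (-m : ℤ) ≤ 1 :=
    zpow_le_one_of_nonpos₀ (Nat.one_le_cast.2 hp.out.one_le) (by simp)
  calc ‖y‖ = ‖y - j + j‖ := by rw [sub_add_cancel]
    _ ≤ max ‖y - j‖ ‖(j : ℚ_[p])‖ := Padic.nonarchimedean _ _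
    _ ≤ 1 := max_le (h.trans hpm) (IsUltrametricDist.norm_natCast_le_one ℚ_[p] j)

theorem closedBall_eq_iUnion (l : ℚ_[p]) (n : ℤ) (m : ℕ) :
    closedBall l ((p : ℝ) ^ (-n)) = ⋃ j : Fin (p ^ m),
      closedBall (l + (p : ℚ_[p]) ^ n * (j : ℕ)) ((p : ℝ) ^ (-(n + m : ℤ))) := by
  have hp0 : (p : ℚ_[p]) ≠ 0 := Nat.cast_ne_zero.2 hp.out.ne_zero
  ext x
  obtain ⟨y, rfl⟩ : ∃ y, l + (p : ℚ_[p]) ^ n * y = x :=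
    ⟨(p : ℚ_[p]) ^ (-n) * (x - l), by rw [← mul_assoc, ← zpow_add₀ hp0]; simp⟩
  simp only [Set.mem_iUnion, add_p_zpow_mul_mem_closedBall_iff,
    add_p_zpow_mul_mem_closedBall_self_iff]
  exact ⟨fun hy => exists_norm_sub_natCast_le hy m,
    fun ⟨_, hj⟩ => norm_le_one_of_norm_sub_natCast_le hj⟩

theorem pairwise_disjoint_closedBall (l : ℚ_[p]) (n : ℤ) (m : ℕ) :
    Pairwise fun i j : Fin (p ^ m) => Disjoint
      (closedBall (l + (p : ℚ_[p]) ^ n * (i : ℕ)) ((p : ℝ) ^ (-(n + m : ℤ))))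
      (closedBall (l + (p : ℚ_[p]) ^ n * (j : ℕ)) ((p : ℝ) ^ (-(n + m : ℤ)))) := by
  refine fun i j hij => (IsUltrametricDist.closedBall_eq_or_disjoint _ _ _).resolve_left
    fun h => hij ?_
  have hi := mem_closedBall_self (x := l + (p : ℚ_[p]) ^ n * (i : ℕ))
    (zpow_nonneg p.cast_nonneg (-(n + m : ℤ)) : (0 : ℝ) ≤ _)
  rw [h, add_p_zpow_mul_mem_closedBall_iff] at hi
  exact eq_of_norm_natCast_sub_le hi

theorem cball_eq_preimage (l : ℚ_[p]) (n : ℤ) :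
    cball (N := N) l n = Subtype.val ⁻¹' closedBall l ((p : ℝ) ^ (-n)) := by
  ext x
  rw [Set.mem_preimage, mem_closedBall_iff_norm]
  rfl

theorem cball_coe (x : Lam p N) (n : ℤ) : cball (x : ℚ_[p]) n = closedBall x ((p : ℝ) ^ (-n)) := by
  rw [cball_eq_preimage, Subtype.preimage_closedBall]

theorem cball_zero_zero : cball (p := p) (N := N) 0 0 = intSet p N := by
  ext x
  simp [cball, intSet]

theorem cball_eq_iUnion (l : ℚ_[p]) (n : ℤ) (m : ℕ) :
    cball (N := N) l n =
      ⋃ j : Fin (p ^ m), cball (l + (p : ℚ_[p]) ^ n * ((j : ℕ) : ℚ_[p])) (n + m) := by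
  simp only [cball_eq_preimage, closedBall_eq_iUnion l n m, Set.preimage_iUnion]

theorem pairwise_disjoint_cball (l : ℚ_[p]) (n : ℤ) (m : ℕ) :
    Pairwise fun i j : Fin (p ^ m) => Disjoint
      (cball (N := N) (l + (p : ℚ_[p]) ^ n * ((i : ℕ) : ℚ_[p])) (n + m))
      (cball (l + (p : ℚ_[p]) ^ n * ((j : ℕ) : ℚ_[p])) (n + m)) := by
  intro i j hij
  simpa only [cball_eq_preimage] using
    (pairwise_disjoint_closedBall l n m hij).preimage Subtype.val

theorem isClosed_Lam : IsClosed (Lam p N) := by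
  simp only [Lam, Set.ofPred_forall]
  exact isClosed_iInter fun k => isClosed_iInter fun _ =>
    isClosed_le continuous_norm continuous_const

instance : ProperSpace (Lam p N) := .of_isClosed isClosed_Lam

theorem isCompact_cball (l : ℚ_[p]) (n : ℤ) : IsCompact (cball (N := N) l n) := by
  rw [cball_eq_preimage]
  exact isClosed_Lam.isClosedEmbedding_subtypeVal.isCompact_preimage (isCompact_closedBall _ _)

theorem mem_Lam_of_norm_le_one {x : ℚ_[p]} (hx : ‖x‖ ≤ 1) : x ∈ Lam p N := fun _ _ =>
  hx.trans (one_le_pow₀ (Nat.one_le_cast.2 hp.out.one_le))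

theorem mem_Lam_of_norm_sub_le_one {x y : ℚ_[p]} (hx : x ∈ Lam p N) (hy : ‖y - x‖ ≤ 1) :
    y ∈ Lam p N := fun k hk =>
  calc ‖y‖ = ‖y - x + x‖ := by rw [sub_add_cancel]
    _ ≤ max ‖y - x‖ ‖x‖ := Padic.nonarchimedean _ _
    _ ≤ (p : ℝ) ^ k := max_le (mem_Lam_of_norm_le_one hy k hk) (hx k hk)

theorem image_val_closedBall (x : Lam p N) {r : ℝ} (hr : r ≤ 1) :
    Subtype.val '' closedBall x r = closedBall (x : ℚ_[p]) r := by
  rw [Subtype.image_closedBall, Set.inter_eq_left]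
  exact fun y hy => mem_Lam_of_norm_sub_le_one x.2 ((mem_closedBall_iff_norm.1 hy).trans hr)

end Balls

section Haar

open Metric

variable {p : ℕ} [hp : Fact p.Prime] {N : ℕ∞} [MeasurableSpace ℚ_[p]] [BorelSpace ℚ_[p]]

instance : (haarQp p).IsAddHaarMeasure := by unfold haarQp; infer_instance

instance : (haarQp p).Regular := by unfold haarQp; infer_instance

theorem haarQp_closedBall (l : ℚ_[p]) (n : ℕ) :
    haarQp p (closedBall l ((p : ℝ) ^ (-n : ℤ))) = ((p : ℝ≥0∞) ^ n)⁻¹ := by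
  refine ENNReal.eq_inv_of_mul_eq_one_left ?_
  calc haarQp p (closedBall l ((p : ℝ) ^ (-n : ℤ))) * (p : ℝ≥0∞) ^ n
      = ∑ j : Fin (p ^ n), haarQp p
          (closedBall (0 + (p : ℚ_[p]) ^ (0 : ℤ) * (j : ℕ)) ((p : ℝ) ^ (-(0 + n : ℤ)))) := by
        simp only [Measure.addHaar_closedBall_center, zero_add, Finset.sum_const,
          Finset.card_univ, Fintype.card_fin, nsmul_eq_mul, Nat.cast_pow, mul_comm]
    _ = haarQp p (closedBall 0 ((p : ℝ) ^ (-0 : ℤ))) := by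
        rw [closedBall_eq_iUnion 0 0 n, measure_iUnion (pairwise_disjoint_closedBall 0 0 n)
          (fun _ => measurableSet_closedBall), tsum_fintype]
    _ = 1 := by
        rw [neg_zero, zpow_zero]
        exact Measure.addHaarMeasure_self (K₀ := intCompact p)

/-- The restriction of the Haar measure to `Λ_N`, as a measure on `Λ_N`. -/
noncomputable def haarLam (p : ℕ) [Fact p.Prime] (N : ℕ∞) [MeasurableSpace ℚ_[p]]
    [BorelSpace ℚ_[p]] : Measure (Lam p N) :=
  (haarQp p).comap Subtype.val

theorem measurableEmbedding_val : MeasurableEmbedding (Subtype.val : Lam p N → ℚ_[p]) :=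
  .subtype_coe isClosed_Lam.measurableSet

theorem haarLam_apply (S : Set (Lam p N)) : haarLam p N S = haarQp p (Subtype.val '' S) :=
  measurableEmbedding_val.comap_apply _ _

instance : (haarLam p N).OuterRegular :=
  Measure.OuterRegular.comap' _ continuous_subtype_val measurableEmbedding_val

theorem haarLam_closedBall (x : Lam p N) (n : ℕ) :
    haarLam p N (closedBall x ((p : ℝ) ^ (-n : ℤ))) = ((p : ℝ≥0∞) ^ n)⁻¹ := by
  rw [haarLam_apply, image_val_closedBall, haarQp_closedBall]
  exact zpow_le_one_of_nonpos₀ (Nat.one_le_cast.2 hp.out.one_le) (by simp)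

end Haar

section Clusters

variable {p : ℕ} [hp : Fact p.Prime] {N : ℕ∞} {ζ : ℝ≥0∞ → ℝ≥0∞}

/-- The clusters `Υ(B)`, `Υ(B')` of disjoint balls intersect in a `k_ζ`-null set. -/
def ClustersAEDisjoint {Y : Type*} [EMetricSpace Y] (ζ : ℝ≥0∞ → ℝ≥0∞) (Υ : Lam p N → Y) : Prop :=
  ∀ (l l' : ℚ_[p]) (n n' : ℤ), Disjoint (cball (N := N) l n) (cball l' n') →
    kMeasure ζ (Υ '' cball l n ∩ Υ '' cball l' n') = 0

section

variable {Y : Type*} [EMetricSpace Y] {Υ : Lam p N → Y}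

theorem kMeasure_iUnion_image_cball (hΥ : Continuous Υ) (hnull : ClustersAEDisjoint ζ Υ)
    {ι : Type*} [Fintype ι] {c : ι → ℚ_[p]} {n : ℤ}
    (hc : Pairwise fun i j => Disjoint (cball (N := N) (c i) n) (cball (c j) n)) :
    kMeasure ζ (⋃ i, Υ '' cball (c i) n) = ∑ i, kMeasure ζ (Υ '' cball (c i) n) := by
  borelize Y
  simp only [ClustersAEDisjoint, kMeasure, OuterMeasure.coe_mkMetric] at hnull ⊢
  rw [measure_iUnion₀ (fun i j hij => hnull _ _ _ _ (hc hij)), tsum_fintype]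
  exact fun i => ((isCompact_cball _ _).image hΥ).measurableSet.nullMeasurableSet

theorem kMeasure_image_cball_eq_sum (hΥ : Continuous Υ) (hnull : ClustersAEDisjoint ζ Υ)
    (l : ℚ_[p]) (n : ℤ) (m : ℕ) :
    kMeasure ζ (Υ '' cball l n) = ∑ j : Fin (p ^ m),
      kMeasure ζ (Υ '' cball (l + (p : ℚ_[p]) ^ n * ((j : ℕ) : ℚ_[p])) (n + m)) := by
  rw [← kMeasure_iUnion_image_cball hΥ hnull (pairwise_disjoint_cball l n m), ← Set.image_iUnion,
    ← cball_eq_iUnion]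

end

variable {d : ℕ} {D : ℝ} {Υ : Lam p N → EuclideanSpace ℝ (Fin d)}

theorem IsAutomodel.kMeasure_image_cball_eq (hΥ : IsAutomodel Υ) (hζ : IsScaleGauge D ζ)
    (hnull : ClustersAEDisjoint ζ Υ) {l : ℚ_[p]} (hl : l ∈ Lam p N) (n : ℤ) :
    kMeasure ζ (Υ '' cball l n) = kMeasure ζ (Υ '' cball 0 n) := by
  obtain ⟨hcont, m, hsplit⟩ := hΥ
  obtain ⟨E, c, hE, hunion, hcopy, hdisj⟩ := hsplit n l hl
  calc kMeasure ζ (Υ '' cball l n) = ∑ j, kMeasure ζ (Υ '' cball (c j) (n + m)) := by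
        rw [hunion, Set.iUnion_congr hcopy, kMeasure_iUnion_image_cball hcont hnull hdisj]
    _ = ∑ j : Fin (p ^ m),
          kMeasure ζ (Υ '' cball (0 + (p : ℚ_[p]) ^ n * ((j : ℕ) : ℚ_[p])) (n + m)) := by
        simp only [← hcopy, hζ.kMeasure_image_of_isometry (hE _), zero_add]
    _ = kMeasure ζ (Υ '' cball 0 n) := (kMeasure_image_cball_eq_sum hcont hnull 0 n m).symm

namespace IsQuasiAutomodel

theorem exists_locallyExpandsBy (hΥ : IsQuasiAutomodel Υ) {L : ℝ≥0} (hL : 1 < L) :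
    ∃ Φ : Lam p N → EuclideanSpace ℝ (Fin d),
      IsAutomodel Φ ∧ LocallyExpandsBy L Υ Φ ∧ LocallyExpandsBy L Φ Υ := by
  obtain ⟨Υs, hΥs, hlim⟩ := hΥ
  obtain ⟨k, hk⟩ := (eventually_locallyExpandsBy hlim hL).exists
  exact ⟨Υs k, hΥs k, hk⟩

theorem continuous (hΥ : IsQuasiAutomodel Υ) : Continuous Υ := by
  obtain ⟨Φ, hΦ, -, hΦΥ⟩ := hΥ.exists_locallyExpandsBy one_lt_two
  exact hΦΥ.continuous hΦ.1

theorem kMeasure_image_cball_le (hΥ : IsQuasiAutomodel Υ) (hζ : IsScaleGauge D ζ) (hD : 0 ≤ D)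
    (hnull : ClustersAEDisjoint ζ Υ) {a b : ℚ_[p]} (ha : a ∈ Lam p N) (hb : b ∈ Lam p N)
    (n : ℤ) : kMeasure ζ (Υ '' cball a n) ≤ kMeasure ζ (Υ '' cball b n) := by
  refine le_of_forall_one_lt_le_rpow_mul (D + D) fun L hL => ?_
  obtain ⟨Φ, hΦ, hΥΦ, hΦΥ⟩ := hΥ.exists_locallyExpandsBy hL
  have hnullΦ : ClustersAEDisjoint ζ Φ := fun l l' n n' hd =>
    hζ.kMeasure_image_inter_image_eq_zero hD hL.le hΥΦ hΦΥ (hnull l l' n n' hd)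
  calc kMeasure ζ (Υ '' cball a n)
      ≤ (L : ℝ≥0∞) ^ D * kMeasure ζ (Φ '' cball a n) := hζ.kMeasure_image_le hD hL.le hΦΥ _
    _ = (L : ℝ≥0∞) ^ D * kMeasure ζ (Φ '' cball b n) := by
        rw [hΦ.kMeasure_image_cball_eq hζ hnullΦ ha, hΦ.kMeasure_image_cball_eq hζ hnullΦ hb]
    _ ≤ (L : ℝ≥0∞) ^ D * ((L : ℝ≥0∞) ^ D * kMeasure ζ (Υ '' cball b n)) := by
        gcongr; exact hζ.kMeasure_image_le hD hL.le hΥΦ _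
    _ = (L : ℝ≥0∞) ^ (D + D) * kMeasure ζ (Υ '' cball b n) := by
        rw [ENNReal.rpow_add_of_nonneg D D hD hD, mul_assoc]

theorem kMeasure_image_cball_eq (hΥ : IsQuasiAutomodel Υ) (hζ : IsScaleGauge D ζ) (hD : 0 ≤ D)
    (hnull : ClustersAEDisjoint ζ Υ) {a b : ℚ_[p]} (ha : a ∈ Lam p N) (hb : b ∈ Lam p N)
    (n : ℤ) : kMeasure ζ (Υ '' cball a n) = kMeasure ζ (Υ '' cball b n) :=
  (hΥ.kMeasure_image_cball_le hζ hD hnull ha hb n).antisymm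
    (hΥ.kMeasure_image_cball_le hζ hD hnull hb ha n)

theorem kMeasure_image_intSet (hΥ : IsQuasiAutomodel Υ) (hζ : IsScaleGauge D ζ) (hD : 0 ≤ D)
    (hnull : ClustersAEDisjoint ζ Υ) {l : ℚ_[p]} (hl : l ∈ Lam p N) (n : ℕ) :
    kMeasure ζ (Υ '' intSet p N) = (p : ℝ≥0∞) ^ n * kMeasure ζ (Υ '' cball l n) := by
  calc kMeasure ζ (Υ '' intSet p N)
      = ∑ j : Fin (p ^ n), kMeasure ζ (Υ '' cball ((j : ℕ) : ℚ_[p]) n) := by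
        rw [← cball_zero_zero, kMeasure_image_cball_eq_sum hΥ.continuous hnull 0 0 n]
        simp only [zpow_zero, one_mul, zero_add]
    _ = ∑ _ : Fin (p ^ n), kMeasure ζ (Υ '' cball l n) :=
        Finset.sum_congr rfl fun j _ => hΥ.kMeasure_image_cball_eq hζ hD hnull
          (mem_Lam_of_norm_le_one (IsUltrametricDist.norm_natCast_le_one ℚ_[p] j)) hl n
    _ = (p : ℝ≥0∞) ^ n * kMeasure ζ (Υ '' cball l n) := by simp

variable [MeasurableSpace ℚ_[p]] [BorelSpace ℚ_[p]]

theorem kMeasure_image_closedBall (hΥ : IsQuasiAutomodel Υ) (hζ : IsScaleGauge D ζ) (hD : 0 ≤ D)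
    (hnull : ClustersAEDisjoint ζ Υ) (x : Lam p N) (n : ℕ) :
    kMeasure ζ (Υ '' Metric.closedBall x ((p : ℝ) ^ (-n : ℤ))) =
      kMeasure ζ (Υ '' intSet p N) * haarLam p N (Metric.closedBall x ((p : ℝ) ^ (-n : ℤ))) := by
  have hpn : (p : ℝ≥0∞) ^ n ≠ 0 := pow_ne_zero _ (Nat.cast_ne_zero.2 hp.out.ne_zero)
  rw [hΥ.kMeasure_image_intSet hζ hD hnull x.2 n, haarLam_closedBall, cball_coe, mul_right_comm,
    ENNReal.mul_inv_cancel hpn (ENNReal.pow_ne_top (ENNReal.natCast_ne_top p)), one_mul]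

theorem kMeasure_image (hΥ : IsQuasiAutomodel Υ) (hζ : IsScaleGauge D ζ) (hD : 0 ≤ D)
    (hnull : ClustersAEDisjoint ζ Υ) (hfin : kMeasure ζ (Υ '' intSet p N) ≠ ∞)
    (T : Set (Lam p N)) :
    kMeasure ζ (Υ '' T) = kMeasure ζ (Υ '' intSet p N) * haarQp p (Subtype.val '' T) := by
  have : (kMeasure ζ (Υ '' intSet p N) • haarLam p N).OuterRegular := .smul _ hfin
  have hp1 : (1 : ℝ) < p := Nat.one_lt_cast.2 hp.out.one_lt
  have hr : Antitone fun n : ℕ => (p : ℝ) ^ (-n : ℤ) := fun m n hmn =>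
    zpow_le_zpow_right₀ hp1.le (by omega)
  have hr_lim : Tendsto (fun n : ℕ => (p : ℝ) ^ (-n : ℤ)) atTop (𝓝 0) := by
    simpa using tendsto_pow_atTop_nhds_zero_of_lt_one (inv_nonneg.2 p.cast_nonneg)
      (inv_lt_one_of_one_lt₀ hp1)
  have himage : Measure.mkMetric ζ (Υ '' T) = (kMeasure ζ (Υ '' intSet p N) • haarLam p N) T := by
    refine measure_image_eq_of_closedBall hΥ.continuous hr (fun n => zpow_pos (one_pos.trans hp1) _)
      hr_lim (fun x n => ?_) (fun x n => ?_) (fun x y m n hd => ?_) T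
    · rw [Measure.smul_apply, haarLam_closedBall]
      exact ENNReal.mul_ne_top hfin
        (ENNReal.inv_ne_top.2 (pow_ne_zero _ (Nat.cast_ne_zero.2 hp.out.ne_zero)))
    · rw [← OuterMeasure.coe_mkMetric]
      exact hΥ.kMeasure_image_closedBall hζ hD hnull x n
    · rw [AEDisjoint, ← OuterMeasure.coe_mkMetric, ← cball_coe, ← cball_coe]
      exact hnull _ _ _ _ (by rwa [cball_coe, cball_coe])
  rwa [← OuterMeasure.coe_mkMetric, Measure.smul_apply, smul_eq_mul, haarLam_apply] at himage

end IsQuasiAutomodel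

end Clusters

end PadicFractal

theorem proposition3 {p : ℕ} [Fact p.Prime] [MeasurableSpace ℚ_[p]] [BorelSpace ℚ_[p]]
    {N : ℕ∞} {d : ℕ} (Υ : PadicFractal.Lam p N → EuclideanSpace ℝ (Fin d))
    (hΥ : PadicFractal.IsQuasiAutomodel Υ)
    (D : ℝ) (hD : 0 ≤ D) (ζ : ℝ≥0∞ → ℝ≥0∞) (hζ : PadicFractal.IsScaleGauge D ζ)
    (hfin : PadicFractal.kMeasure ζ (Υ '' PadicFractal.intSet p N) < ∞)
    (hnull : ∀ (l l' : ℚ_[p]) (n n' : ℤ),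
      Disjoint (PadicFractal.cball (N := N) l n) (PadicFractal.cball l' n') →
        PadicFractal.kMeasure ζ
          (Υ '' PadicFractal.cball l n ∩ Υ '' PadicFractal.cball l' n') = 0) :
    (∀ A : Set (EuclideanSpace ℝ (Fin d)),
      PadicFractal.kMeasure ζ (A ∩ Set.range Υ) =
        PadicFractal.kMeasure ζ (Υ '' PadicFractal.intSet p N) *
          PadicFractal.haarQp p (Subtype.val '' (Υ ⁻¹' A))) ∧
    (PadicFractal.kMeasure ζ (Υ '' PadicFractal.intSet p N) ≠ 0 →
      ∀ A : Set (EuclideanSpace ℝ (Fin d)),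
        (PadicFractal.kMeasure ζ (Υ '' PadicFractal.intSet p N))⁻¹ *
            PadicFractal.kMeasure ζ (A ∩ Set.range Υ) =
          PadicFractal.haarQp p (Subtype.val '' (Υ ⁻¹' A))) := by
  have himage := hΥ.kMeasure_image hζ hD hnull hfin.ne
  refine ⟨fun A => ?_, fun hne A => ?_⟩
  · rw [← Set.image_preimage_eq_inter_range, himage]
  · rw [← Set.image_preimage_eq_inter_range, himage (Υ ⁻¹' A), ← mul_assoc,
      ENNReal.inv_mul_cancel hne hfin.ne, one_mul]
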